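/- Let $d\in\{2,3\}$ and let $\Omega\subset\mathbb R^d$ be a bounded Lipschitz domain with polyhedral boundary $\Gamma=\partial\Omega=\overline{\Gamma}_D\cup\overline{\Gamma}_N$, where $\Gamma_D,\Gamma_N\subseteq\Gamma$ are relatively open and disjoint and $\Gamma_D$ has positive surface measure. Let $\mathcal H:=H^1_D(\Omega)=\{w\in H^1(\Omega): w=0 \text{ on }\Gamma_D\text{ in the sense of traces}\}$ (real-valued functions), with $\|v\|_{\mathcal H}:=\|\nabla v\|_{L^2(\Omega)}$. Let $\mu:\Omega\times\mathbb R_{\ge0}\to\mathbb R$ be such that $\mu(\cdot,t)$ is measurable for every $t\ge 0$ and such that * (M1) there are constants $0<\gamma_1<\gamma_2<\infty$ with $\gamma_1\le\mu(x,t)\le\gamma_2$ for all $x\in\Omega$ and $t\ge0$; * (M2) $\mu(x,\cdot)\in C^1(\mathbb R_{\ge0},\mathbb R)$ for all $x\in\Omega$, and there are constants $0<\widetilde\gamma_1<\widetilde\gamma_2<\infty$ with $\widetilde\gamma_1\le\mu(x,t)+2t\,\frac{d}{dt}\mu(x,t)\le\widetilde\gamma_2$ for all $x\in\Omega$ and $t\ge0$.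 Then $$\langle Aw,v\rangle:=\int_\Omega\mu(x,|\nabla w(x)|^2)\,\nabla w(x)\cdot\nabla v(x)\,dx\qquad(v,w\in\mathcal H)$$ defines an operator $A:\mathcal H\to\mathcal H^*$ with the following properties. * $A$ is strongly monotone with constant $\alpha=\widetilde\gamma_1$: $\ \widetilde\gamma_1\|w-v\|_{\mathcal H}^2\le\langle Aw-Av,w-v\rangle$ for all $v,w\in\mathcal H$. * $A$ is Lipschitz continuous with constant $L=\widetilde\gamma_2$: $\ \|Aw-Av\|_{\mathcal H^*}\le\widetilde\gamma_2\|w-v\|_{\mathcal H}$ for all $v,w\in\mathcal H$. * $A$ has a potential: the function $$P:\mathcal H\to\mathbb R_{\ge0},\qquad P(w):=\frac12\int_\Omega\int_0^{|\nabla w(x)|^2}\mu(x,\zeta)\,d\zeta\,dx,$$ is well defined and Gâteaux differentiable with derivative $A$, i.e. $\langle Aw,v\rangle=\lim_{r\to0,\,r\in\mathbb R}\frac{P(w+rv)-P(w)}{r}$ for all $v,w\in\mathcal H$. -/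

import Mathlib

open MeasureTheory Filter Topology
open scoped ENNReal NNReal ContDiff RealInnerProductSpace

noncomputable section

/-! ### Bounded Lipschitz domains with polyhedral boundary -/

/-- `Ω ⊆ ℝᵈ` is a bounded Lipschitz domain: nonempty, open, connected, bounded, and around every
boundary point `x₀` the set `Ω` is, in suitable orthonormal coordinates, the set of points lying
strictly above the graph of a Lipschitz function `γ`. Here `e` is the vertical unit vector of the
coordinate system, `⟪e, y⟫` is the vertical coordinate of `y`, and the orthogonal projection of `y`
onto the orthogonal complement of `e` collects the horizontal coordinates. -/
structure IsBoundedLipschitzDomain {d : ℕ} (Ω : Set (EuclideanSpace ℝ (Fin d))) : Prop where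
  isOpen : IsOpen Ω
  isConnected : IsConnected Ω
  isBounded : Bornology.IsBounded Ω
  lipschitz_boundary : ∀ x₀ ∈ frontier Ω, ∃ e : EuclideanSpace ℝ (Fin d), ‖e‖ = 1 ∧
    ∃ (γ : ((ℝ ∙ e)ᗮ : Submodule ℝ (EuclideanSpace ℝ (Fin d))) → ℝ) (K : ℝ≥0),
      LipschitzWith K γ ∧
      ∃ r > 0, ∀ y ∈ Metric.ball x₀ r,
        (y ∈ Ω ↔ γ ((ℝ ∙ e)ᗮ.orthogonalProjectionOnto y) < ⟪e, y⟫)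

/-- The boundary of `Ω` is polyhedral: it is a union of finitely many polytopes (convex hulls of
finite sets). -/
def HasPolyhedralBoundary {d : ℕ} (Ω : Set (EuclideanSpace ℝ (Fin d))) : Prop :=
  ∃ F : Finset (Finset (EuclideanSpace ℝ (Fin d))),
    frontier Ω = ⋃ V ∈ F, convexHull ℝ (V : Set (EuclideanSpace ℝ (Fin d)))

/-- The surface measure on `∂Ω`: the `(d-1)`-dimensional Euclidean Hausdorff measure restricted
to `∂Ω` (used for `d ≥ 1`). -/
def boundaryMeasure {d : ℕ} (Ω : Set (EuclideanSpace ℝ (Fin d))) :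
    Measure (EuclideanSpace ℝ (Fin d)) :=
  (μHE[d - 1]).restrict (frontier Ω)

/-- `∂Ω` is split into the disjoint relatively open parts `ΓD`, `ΓN`, whose closures cover `∂Ω`,
and `ΓD` has positive surface measure. -/
structure IsBoundarySplit {d : ℕ} (Ω ΓD ΓN : Set (EuclideanSpace ℝ (Fin d))) : Prop where
  isOpen_dirichlet : ∃ U, IsOpen U ∧ ΓD = U ∩ frontier Ω
  isOpen_neumann : ∃ U, IsOpen U ∧ ΓN = U ∩ frontier Ω
  disjoint : Disjoint ΓD ΓN
  closure_union : frontier Ω = closure ΓD ∪ closure ΓN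
  measure_pos : 0 < boundaryMeasure Ω ΓD

/-! ### The spaces `H¹(Ω)` and `H¹_D(Ω)` -/

/-- `G` is the weak gradient of `u` on `Ω`:
`∫_Ω u ∂ᵢφ dx = - ∫_Ω Gᵢ φ dx` for all test functions `φ ∈ C_c^∞(Ω)` and all `i`. -/
def IsWeakGradient {d : ℕ} (Ω : Set (EuclideanSpace ℝ (Fin d)))
    (u : EuclideanSpace ℝ (Fin d) → ℝ)
    (G : EuclideanSpace ℝ (Fin d) → EuclideanSpace ℝ (Fin d)) : Prop :=
  ∀ φ : EuclideanSpace ℝ (Fin d) → ℝ, ContDiff ℝ ∞ φ → HasCompactSupport φ → tsupport φ ⊆ Ω →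
    ∀ i : Fin d, ∫ x in Ω, u x * fderiv ℝ φ x (EuclideanSpace.single i 1)
      = - ∫ x in Ω, G x i * φ x

theorem IsWeakGradient.congr {d : ℕ} {Ω : Set (EuclideanSpace ℝ (Fin d))}
    {u u' : EuclideanSpace ℝ (Fin d) → ℝ}
    {G G' : EuclideanSpace ℝ (Fin d) → EuclideanSpace ℝ (Fin d)}
    (h : IsWeakGradient Ω u G) (hu : u =ᵐ[volume.restrict Ω] u')
    (hG : G =ᵐ[volume.restrict Ω] G') : IsWeakGradient Ω u' G' := by
  intro φ hφ hc hs i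
  have h1 : ∫ x in Ω, u' x * fderiv ℝ φ x (EuclideanSpace.single i 1)
      = ∫ x in Ω, u x * fderiv ℝ φ x (EuclideanSpace.single i 1) := by
    refine integral_congr_ae ?_
    filter_upwards [hu] with x hx
    rw [hx]
  have h2 : ∫ x in Ω, G' x i * φ x = ∫ x in Ω, G x i * φ x := by
    refine integral_congr_ae ?_
    filter_upwards [hG] with x hx
    rw [hx]
  rw [h1, h2]
  exact h φ hφ hc hs i

theorem IsWeakGradient.add_smul {d : ℕ} {Ω : Set (EuclideanSpace ℝ (Fin d))} (c : ℝ)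
    {u u' : EuclideanSpace ℝ (Fin d) → ℝ}
    {G G' : EuclideanSpace ℝ (Fin d) → EuclideanSpace ℝ (Fin d)}
    (h : IsWeakGradient Ω u G) (h' : IsWeakGradient Ω u' G')
    (hu : MemLp u 2 (volume.restrict Ω)) (hu' : MemLp u' 2 (volume.restrict Ω))
    (hG : MemLp G 2 (volume.restrict Ω)) (hG' : MemLp G' 2 (volume.restrict Ω)) :
    IsWeakGradient Ω (fun x => u x + c * u' x) (fun x => G x + c • G' x) := by
  intro φ hφ hc hs i
  have hdφ : MemLp (fun x => fderiv ℝ φ x (EuclideanSpace.single i 1)) 2 (volume.restrict Ω) := by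
    have hcont : Continuous (fun x => fderiv ℝ φ x (EuclideanSpace.single i 1)) :=
      (hφ.continuous_fderiv (by simp)).clm_apply continuous_const
    exact (hcont.memLp_of_hasCompactSupport (hc.fderiv_apply ℝ _)).restrict _
  have hφ2 : MemLp φ 2 (volume.restrict Ω) :=
    (hφ.continuous.memLp_of_hasCompactSupport hc).restrict _
  have hcoord : ∀ {F : EuclideanSpace ℝ (Fin d) → EuclideanSpace ℝ (Fin d)},
      MemLp F 2 (volume.restrict Ω) → MemLp (fun x => F x i) 2 (volume.restrict Ω) := by
    intro F hF
    exact (EuclideanSpace.proj (𝕜 := ℝ) i).comp_memLp' hF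
  have i1 : Integrable (fun x => u x * fderiv ℝ φ x (EuclideanSpace.single i 1))
      (volume.restrict Ω) := hu.integrable_mul hdφ
  have i2 : Integrable (fun x => c * (u' x * fderiv ℝ φ x (EuclideanSpace.single i 1)))
      (volume.restrict Ω) := (hu'.integrable_mul hdφ).const_mul c
  have i3 : Integrable (fun x => G x i * φ x) (volume.restrict Ω) := (hcoord hG).integrable_mul hφ2
  have i4 : Integrable (fun x => c * (G' x i * φ x)) (volume.restrict Ω) :=
    ((hcoord hG').integrable_mul hφ2).const_mul c
  have e1 : ∫ x in Ω, (u x + c * u' x) * fderiv ℝ φ x (EuclideanSpace.single i 1)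
      = (∫ x in Ω, u x * fderiv ℝ φ x (EuclideanSpace.single i 1))
        + c * ∫ x in Ω, u' x * fderiv ℝ φ x (EuclideanSpace.single i 1) := by
    rw [← integral_const_mul, ← integral_add i1 i2]
    refine integral_congr_ae (Eventually.of_forall fun x => ?_)
    ring
  have e2 : ∫ x in Ω, (G x + c • G' x) i * φ x
      = (∫ x in Ω, G x i * φ x) + c * ∫ x in Ω, G' x i * φ x := by
    rw [← integral_const_mul, ← integral_add i3 i4]
    refine integral_congr_ae (Eventually.of_forall fun x => ?_)
    simp only [PiLp.add_apply, PiLp.smul_apply, smul_eq_mul]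
    ring
  rw [e1, e2, h φ hφ hc hs i, h' φ hφ hc hs i]
  ring

/-- The function `g ∈ L²(∂Ω)` is the trace of the function `u ∈ H¹(Ω)` with weak gradient `G`.
The trace operator `H¹(Ω) → L²(∂Ω)` of a bounded Lipschitz domain is the continuous extension of the
restriction `φ ↦ φ|_∂Ω` from the functions that are smooth up to the boundary, which are dense in
`H¹(Ω)`. So `g` is the trace of `u` iff there are smooth `φₙ` with `φₙ → u` in `H¹(Ω)` and
`φₙ|_∂Ω → g` in `L²(∂Ω)`. -/
def HasTrace {d : ℕ} (Ω : Set (EuclideanSpace ℝ (Fin d)))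
    (u : EuclideanSpace ℝ (Fin d) → ℝ)
    (G : EuclideanSpace ℝ (Fin d) → EuclideanSpace ℝ (Fin d))
    (g : EuclideanSpace ℝ (Fin d) → ℝ) : Prop :=
  MemLp g 2 (boundaryMeasure Ω) ∧
  ∃ φ : ℕ → EuclideanSpace ℝ (Fin d) → ℝ, (∀ n, ContDiff ℝ ∞ (φ n)) ∧
    Tendsto (fun n => eLpNorm (fun x => φ n x - u x) 2 (volume.restrict Ω)) atTop (𝓝 0) ∧
    Tendsto (fun n => eLpNorm (fun x => gradient (φ n) x - G x) 2 (volume.restrict Ω))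
      atTop (𝓝 0) ∧
    Tendsto (fun n => eLpNorm (fun x => φ n x - g x) 2 (boundaryMeasure Ω)) atTop (𝓝 0)

theorem HasTrace.congr {d : ℕ} {Ω : Set (EuclideanSpace ℝ (Fin d))}
    {u u' : EuclideanSpace ℝ (Fin d) → ℝ}
    {G G' : EuclideanSpace ℝ (Fin d) → EuclideanSpace ℝ (Fin d)}
    {g : EuclideanSpace ℝ (Fin d) → ℝ}
    (h : HasTrace Ω u G g) (hu : u =ᵐ[volume.restrict Ω] u')
    (hG : G =ᵐ[volume.restrict Ω] G') : HasTrace Ω u' G' g := by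
  obtain ⟨hg, φ, hφ, h1, h2, h3⟩ := h
  refine ⟨hg, φ, hφ, ?_, ?_, h3⟩
  · refine h1.congr fun n => eLpNorm_congr_ae ?_
    filter_upwards [hu] with x hx
    rw [hx]
  · refine h2.congr fun n => eLpNorm_congr_ae ?_
    filter_upwards [hG] with x hx
    rw [hx]

theorem tendsto_eLpNorm_add_smul {X F : Type*} [MeasurableSpace X] [NormedAddCommGroup F]
    [NormedSpace ℝ F] {ν : Measure X} (c : ℝ) {f f' : ℕ → X → F}
    (hf : ∀ n, AEStronglyMeasurable (f n) ν) (hf' : ∀ n, AEStronglyMeasurable (f' n) ν)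
    (h : Tendsto (fun n => eLpNorm (f n) 2 ν) atTop (𝓝 0))
    (h' : Tendsto (fun n => eLpNorm (f' n) 2 ν) atTop (𝓝 0)) :
    Tendsto (fun n => eLpNorm (f n + c • f' n) 2 ν) atTop (𝓝 0) := by
  have hlim : Tendsto (fun n => eLpNorm (f n) 2 ν + ‖c‖ₑ * eLpNorm (f' n) 2 ν) atTop (𝓝 0) := by
    have h2 := ENNReal.Tendsto.const_mul (a := ‖c‖ₑ) h' (Or.inr enorm_ne_top)
    simpa using h.add h2
  refine tendsto_of_tendsto_of_tendsto_of_le_of_le tendsto_const_nhds hlim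
    (fun n => zero_le) fun n => ?_
  refine (eLpNorm_add_le (hf n) ((hf' n).const_smul c) (by norm_num)).trans ?_
  rw [eLpNorm_const_smul]

theorem HasTrace.add_smul {d : ℕ} {Ω : Set (EuclideanSpace ℝ (Fin d))} (c : ℝ)
    {u u' : EuclideanSpace ℝ (Fin d) → ℝ}
    {G G' : EuclideanSpace ℝ (Fin d) → EuclideanSpace ℝ (Fin d)}
    {g g' : EuclideanSpace ℝ (Fin d) → ℝ}
    (h : HasTrace Ω u G g) (h' : HasTrace Ω u' G' g')
    (hu : MemLp u 2 (volume.restrict Ω)) (hu' : MemLp u' 2 (volume.restrict Ω))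
    (hG : MemLp G 2 (volume.restrict Ω)) (hG' : MemLp G' 2 (volume.restrict Ω)) :
    HasTrace Ω (fun x => u x + c * u' x) (fun x => G x + c • G' x)
      (fun x => g x + c * g' x) := by
  obtain ⟨hg, φ, hφ, h1, h2, h3⟩ := h
  obtain ⟨hg', φ', hφ', h1', h2', h3'⟩ := h'
  have hgc : ∀ {ψ : EuclideanSpace ℝ (Fin d) → ℝ}, ContDiff ℝ ∞ ψ →
      Continuous (gradient ψ) := fun hψ =>
    (InnerProductSpace.toDual ℝ (EuclideanSpace ℝ (Fin d))).symm.continuous.comp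
      (hψ.continuous_fderiv (by simp))
  refine ⟨hg.add (hg'.const_mul c), fun n x => φ n x + c * φ' n x,
    fun n => (hφ n).add (contDiff_const.mul (hφ' n)), ?_, ?_, ?_⟩
  · refine (tendsto_eLpNorm_add_smul c
      (fun n => (hφ n).continuous.aestronglyMeasurable.sub hu.1)
      (fun n => (hφ' n).continuous.aestronglyMeasurable.sub hu'.1) h1 h1').congr fun n => ?_
    congr 1
    funext x
    simp only [Pi.add_apply, Pi.smul_apply, Pi.sub_apply, smul_eq_mul]
    ring
  · refine (tendsto_eLpNorm_add_smul c
      (fun n => (hgc (hφ n)).aestronglyMeasurable.sub hG.1)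
      (fun n => (hgc (hφ' n)).aestronglyMeasurable.sub hG'.1) h2 h2').congr fun n => ?_
    congr 1
    funext x
    have d1 : DifferentiableAt ℝ (φ n) x := (hφ n).differentiable (by simp) x
    have d2 : DifferentiableAt ℝ (φ' n) x := (hφ' n).differentiable (by simp) x
    have e : gradient (fun x => φ n x + c * φ' n x) x
        = gradient (φ n) x + c • gradient (φ' n) x := by
      simp only [gradient]
      rw [fderiv_fun_add d1 (d2.const_mul c), fderiv_const_mul d2]
      simp
    simp only [Pi.add_apply, Pi.smul_apply, Pi.sub_apply, e, smul_sub]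
    abel
  · refine (tendsto_eLpNorm_add_smul c
      (fun n => (hφ n).continuous.aestronglyMeasurable.sub hg.1)
      (fun n => (hφ' n).continuous.aestronglyMeasurable.sub hg'.1) h3 h3').congr fun n => ?_
    congr 1
    funext x
    simp only [Pi.add_apply, Pi.smul_apply, Pi.sub_apply, smul_eq_mul]
    ring

theorem HasTrace.zero {d : ℕ} (Ω : Set (EuclideanSpace ℝ (Fin d))) :
    HasTrace Ω (fun _ => 0) (fun _ => 0) (fun _ => 0) := by
  refine ⟨MemLp.zero', fun _ _ => 0, fun _ => contDiff_const, ?_, ?_, ?_⟩ <;>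
    simp [gradient]

theorem coeFn_add_smul_ae {X F : Type*} [MeasurableSpace X] [NormedAddCommGroup F]
    [NormedSpace ℝ F] {ν : Measure X} (c : ℝ) (f f' : Lp F 2 ν) :
    (fun x => f x + c • f' x) =ᵐ[ν] (f + c • f' : Lp F 2 ν) := by
  filter_upwards [Lp.coeFn_add f (c • f'), Lp.coeFn_smul c f'] with x h1 h2
  rw [h1, Pi.add_apply, h2, Pi.smul_apply]

/-- The Sobolev space `H¹(Ω)`: a function `u ∈ L²(Ω)` that has a weak gradient in `L²(Ω; ℝᵈ)`,
recorded as the pair of `u` and its (unique) weak gradient. -/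
def sobolevH1 {d : ℕ} (Ω : Set (EuclideanSpace ℝ (Fin d))) :
    Submodule ℝ (Lp ℝ 2 (volume.restrict Ω) ×
      Lp (EuclideanSpace ℝ (Fin d)) 2 (volume.restrict Ω)) where
  carrier := {p | IsWeakGradient Ω p.1 p.2}
  zero_mem' := by
    have h : IsWeakGradient Ω (fun _ => 0) (fun _ => 0) := by
      intro φ _ _ _ i
      simp
    exact h.congr (Lp.coeFn_zero ..).symm (Lp.coeFn_zero ..).symm
  add_mem' := by
    intro p q hp hq
    have h := IsWeakGradient.add_smul 1 hp hq (Lp.memLp _) (Lp.memLp _) (Lp.memLp _) (Lp.memLp _)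
    have e := h.congr (coeFn_add_smul_ae 1 p.1 q.1) (coeFn_add_smul_ae 1 p.2 q.2)
    rw [one_smul, one_smul] at e
    exact e
  smul_mem' := by
    intro c p hp
    have h0 : IsWeakGradient Ω ((0 : Lp ℝ 2 (volume.restrict Ω)) : _ → ℝ)
        ((0 : Lp (EuclideanSpace ℝ (Fin d)) 2 (volume.restrict Ω)) : _ → _) := by
      have h : IsWeakGradient Ω (fun _ => 0) (fun _ => 0) := by
        intro φ _ _ _ i
        simp
      exact h.congr (Lp.coeFn_zero ..).symm (Lp.coeFn_zero ..).symm
    have h := IsWeakGradient.add_smul c h0 hp (Lp.memLp _) (Lp.memLp _) (Lp.memLp _) (Lp.memLp _)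
    have e := h.congr (coeFn_add_smul_ae c 0 p.1) (coeFn_add_smul_ae c 0 p.2)
    rw [zero_add, zero_add] at e
    exact e

/-- `H¹_D(Ω)`: the functions in `H¹(Ω)` whose trace vanishes (almost everywhere with respect to the
surface measure) on `ΓD`. -/
def sobolevH1D {d : ℕ} (Ω ΓD : Set (EuclideanSpace ℝ (Fin d))) :
    Submodule ℝ (Lp ℝ 2 (volume.restrict Ω) ×
      Lp (EuclideanSpace ℝ (Fin d)) 2 (volume.restrict Ω)) where
  carrier := {p | p ∈ sobolevH1 Ω ∧ ∃ g, HasTrace Ω p.1 p.2 g ∧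
    ∀ᵐ x ∂(boundaryMeasure Ω), x ∈ ΓD → g x = 0}
  zero_mem' := by
    refine ⟨(sobolevH1 Ω).zero_mem, fun _ => 0, ?_, Eventually.of_forall fun _ _ => rfl⟩
    exact (HasTrace.zero Ω).congr (Lp.coeFn_zero ..).symm (Lp.coeFn_zero ..).symm
  add_mem' := by
    rintro p q ⟨hp, g, hg, hg0⟩ ⟨hq, g', hg', hg0'⟩
    have h := HasTrace.add_smul 1 hg hg' (Lp.memLp _) (Lp.memLp _) (Lp.memLp _) (Lp.memLp _)
    have e := h.congr (coeFn_add_smul_ae 1 p.1 q.1) (coeFn_add_smul_ae 1 p.2 q.2)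
    rw [one_smul, one_smul] at e
    refine ⟨(sobolevH1 Ω).add_mem hp hq, _, e, ?_⟩
    filter_upwards [hg0, hg0'] with x h1 h2 hx
    simp [h1 hx, h2 hx]
  smul_mem' := by
    rintro c p ⟨hp, g, hg, hg0⟩
    have h0 : HasTrace Ω ((0 : Lp ℝ 2 (volume.restrict Ω)) : _ → ℝ)
        ((0 : Lp (EuclideanSpace ℝ (Fin d)) 2 (volume.restrict Ω)) : _ → _) (fun _ => 0) :=
      (HasTrace.zero Ω).congr (Lp.coeFn_zero ..).symm (Lp.coeFn_zero ..).symm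
    have h := HasTrace.add_smul c h0 hg (Lp.memLp _) (Lp.memLp _) (Lp.memLp _) (Lp.memLp _)
    have e := h.congr (coeFn_add_smul_ae c 0 p.1) (coeFn_add_smul_ae c 0 p.2)
    rw [zero_add, zero_add] at e
    refine ⟨(sobolevH1 Ω).smul_mem c hp, _, e, ?_⟩
    filter_upwards [hg0] with x h1 hx
    simp [h1 hx]

/-- The space `𝓗 = H¹_D(Ω)` as a type of its own, because it does not carry the norm of the product
`L²(Ω) × L²(Ω; ℝᵈ)` but the norm `‖v‖ = ‖∇v‖_{L²(Ω)}`. -/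
def H1D {d : ℕ} (Ω ΓD : Set (EuclideanSpace ℝ (Fin d))) : Type := sobolevH1D Ω ΓD

namespace H1D

variable {d : ℕ} {Ω ΓD : Set (EuclideanSpace ℝ (Fin d))}

instance : AddCommGroup (H1D Ω ΓD) := inferInstanceAs (AddCommGroup (sobolevH1D Ω ΓD))

instance : Module ℝ (H1D Ω ΓD) := inferInstanceAs (Module ℝ (sobolevH1D Ω ΓD))

/-- The weak gradient `∇ : H¹_D(Ω) → L²(Ω; ℝᵈ)`. -/
def grad : H1D Ω ΓD →ₗ[ℝ] Lp (EuclideanSpace ℝ (Fin d)) 2 (volume.restrict Ω) :=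
  (LinearMap.snd ℝ (Lp ℝ 2 (volume.restrict Ω))
    (Lp (EuclideanSpace ℝ (Fin d)) 2 (volume.restrict Ω))).comp (sobolevH1D Ω ΓD).subtype

/-- `‖v‖ = ‖∇v‖_{L²(Ω)}`. Definiteness and completeness (both consequences of Friedrichs' inequality)
are not recorded in the instance; the dual space and its operator norm do not depend on them. -/
instance : SeminormedAddCommGroup (H1D Ω ΓD) :=
  SeminormedAddCommGroup.induced (H1D Ω ΓD)
    (Lp (EuclideanSpace ℝ (Fin d)) 2 (volume.restrict Ω)) (grad (Ω := Ω) (ΓD := ΓD))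

instance : NormedSpace ℝ (H1D Ω ΓD) :=
  NormedSpace.induced ℝ (H1D Ω ΓD)
    (Lp (EuclideanSpace ℝ (Fin d)) 2 (volume.restrict Ω)) (grad (Ω := Ω) (ΓD := ΓD))

end H1D

/-! ### Properties of operators `A : 𝓗 → 𝓗*` -/

/-- `A` is strongly monotone with constant `α > 0`. -/
def IsStronglyMonotoneWith {H : Type*} [SeminormedAddCommGroup H] [NormedSpace ℝ H]
    (α : ℝ) (A : H → StrongDual ℝ H) : Prop :=
  0 < α ∧ ∀ v w : H, α * ‖w - v‖ ^ 2 ≤ (A w - A v) (w - v)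

/-- `A` is Lipschitz continuous with constant `L > 0`, with respect to the dual norm on `𝓗*`. -/
def IsLipschitzContinuousWith {H : Type*} [SeminormedAddCommGroup H] [NormedSpace ℝ H]
    (L : ℝ) (A : H → StrongDual ℝ H) : Prop :=
  0 < L ∧ ∀ v w : H, ‖A w - A v‖ ≤ L * ‖w - v‖

/-- `P` is a potential of `A`: `P` is Gâteaux differentiable with derivative `dP = A`. -/
def IsPotentialOf {H : Type*} [SeminormedAddCommGroup H] [NormedSpace ℝ H]
    (P : H → ℝ) (A : H → StrongDual ℝ H) : Prop :=
  ∀ v w : H, Tendsto (fun r : ℝ => (P (w + r • v) - P w) / r) (𝓝[≠] 0) (𝓝 (A w v))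

/-! ### The scalar nonlinearity and the quasilinear operator -/

/-- Boundedness of `μ : Ω × ℝ≥0 → ℝ`: `γ₁ ≤ μ(x,t) ≤ γ₂` with `0 < γ₁ < γ₂`. -/
def NonlinearityBounded {d : ℕ} (Ω : Set (EuclideanSpace ℝ (Fin d)))
    (μ : EuclideanSpace ℝ (Fin d) → ℝ → ℝ) (γ₁ γ₂ : ℝ) : Prop :=
  0 < γ₁ ∧ γ₁ < γ₂ ∧ ∀ x ∈ Ω, ∀ t : ℝ, 0 ≤ t → γ₁ ≤ μ x t ∧ μ x t ≤ γ₂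

/-- `μ(x,·) ∈ C¹(ℝ≥0)` and `γ₁ ≤ μ(x,t) + 2 t ∂ₜμ(x,t) ≤ γ₂` with `0 < γ₁ < γ₂`; the derivative at
`t = 0` is the one-sided one. -/
def NonlinearityDifferentiable {d : ℕ} (Ω : Set (EuclideanSpace ℝ (Fin d)))
    (μ : EuclideanSpace ℝ (Fin d) → ℝ → ℝ) (γ₁ γ₂ : ℝ) : Prop :=
  0 < γ₁ ∧ γ₁ < γ₂ ∧ (∀ x ∈ Ω, ContDiffOn ℝ 1 (μ x) (Set.Ici 0)) ∧
    ∀ x ∈ Ω, ∀ t : ℝ, 0 ≤ t →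
      γ₁ ≤ μ x t + 2 * t * derivWithin (μ x) (Set.Ici 0) t ∧
      μ x t + 2 * t * derivWithin (μ x) (Set.Ici 0) t ≤ γ₂

/-- The integrand `μ(x,|∇w(x)|²) ∇w(x)·∇v(x)` of `⟨Aw,v⟩`. -/
def operatorDensity {d : ℕ} {Ω ΓD : Set (EuclideanSpace ℝ (Fin d))}
    (μ : EuclideanSpace ℝ (Fin d) → ℝ → ℝ) (w v : H1D Ω ΓD) (x : EuclideanSpace ℝ (Fin d)) : ℝ :=
  μ x (‖w.grad x‖ ^ 2) * ⟪w.grad x, v.grad x⟫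

/-- The integrand `∫₀^{|∇w(x)|²} μ(x,ζ) dζ` of the potential. -/
def energyDensity {d : ℕ} {Ω ΓD : Set (EuclideanSpace ℝ (Fin d))}
    (μ : EuclideanSpace ℝ (Fin d) → ℝ → ℝ) (w : H1D Ω ΓD) (x : EuclideanSpace ℝ (Fin d)) : ℝ :=
  ∫ ζ in (0 : ℝ)..(‖w.grad x‖ ^ 2), μ x ζ

/-- `P(w) = ½ ∫_Ω ∫₀^{|∇w(x)|²} μ(x,ζ) dζ dx`. -/
def energyPotential {d : ℕ} {Ω ΓD : Set (EuclideanSpace ℝ (Fin d))}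
    (μ : EuclideanSpace ℝ (Fin d) → ℝ → ℝ) (w : H1D Ω ΓD) : ℝ :=
  (1 / 2) * ∫ x in Ω, energyDensity μ w x

end

/-! ### Pointwise estimates for the vector field `ξ ↦ m(|ξ|²) ξ` -/

section Pointwise

variable {m : ℝ → ℝ} {α L : ℝ}

/-! Everything reduces to the vector field ξ ↦ m(|ξ|²)ξ with m = μ(x,·). Its radial profile s ↦
s·m(s²) has derivative m(s²) + 2s²m'(s²), exactly the quantity bounded in (M2), so by the mean value
theorem the profile grows with slope between α and L. Splitting |ξ-η|² into a radial part (|ξ|-|η|)²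
and an angular part 2(|ξ||η| - ⟨ξ,η⟩) ≥ 0 lifts this to vectors with the same constants:
`mul_norm_sub_sq_le_inner_smul_sub_smul` and `norm_smul_sub_smul_le`.

A w is the functional v ↦ ⟨F, ∇v⟩ in L² with flux F = μ(·,|∇w|²)∇w. Integrating the pointwise
estimates gives monotonicity, and with Cauchy–Schwarz the Lipschitz bound. The potential is
differentiated under the integral by dominated convergence. Measurability of these compositions
comes from a Carathéodory argument. -/

theorem hasDerivAt_mul_comp_sq (hm : ContDiffOn ℝ 1 m (Set.Ici 0)) {s : ℝ} (hs : 0 < s) :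
    HasDerivAt (fun s => s * m (s ^ 2))
      (m (s ^ 2) + 2 * s ^ 2 * derivWithin m (Set.Ici 0) (s ^ 2)) s := by
  have hs2 : 0 < s ^ 2 := by positivity
  have h1 : HasDerivAt m (derivWithin m (Set.Ici 0) (s ^ 2)) (s ^ 2) :=
    ((hm.differentiableOn one_ne_zero) _ hs2.le).hasDerivWithinAt.hasDerivAt (Ici_mem_nhds hs2)
  have h2 : HasDerivAt (fun s : ℝ => s ^ 2) (2 * s) s := by simpa using hasDerivAt_pow 2 s
  have h3 := (hasDerivAt_id s).mul (HasDerivAt.comp (h₂ := m) (h := fun s => s ^ 2) s h1 h2)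
  refine h3.congr_deriv ?_
  simp only [id, Function.comp]
  ring

theorem continuousOn_mul_comp_sq (hm : ContinuousOn m (Set.Ici 0)) :
    ContinuousOn (fun s => s * m (s ^ 2)) (Set.Ici 0) :=
  continuousOn_id.mul (hm.comp (by fun_prop) fun s _ => sq_nonneg s)

theorem mul_sub_le_mul_comp_sq_sub (hm : ContDiffOn ℝ 1 m (Set.Ici 0))
    (hα : ∀ t, 0 ≤ t → α ≤ m t + 2 * t * derivWithin m (Set.Ici 0) t)
    {s t : ℝ} (hs : 0 ≤ s) (hst : s ≤ t) :
    α * (t - s) ≤ t * m (t ^ 2) - s * m (s ^ 2) := by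
  refine (convex_Ici (0 : ℝ)).mul_sub_le_image_sub_of_le_deriv
    (continuousOn_mul_comp_sq hm.continuousOn) ?_ ?_ s hs t (hs.trans hst) hst
  · intro x hx
    rw [interior_Ici] at hx
    exact (hasDerivAt_mul_comp_sq hm hx).differentiableAt.differentiableWithinAt
  · intro x hx
    rw [interior_Ici] at hx
    rw [(hasDerivAt_mul_comp_sq hm hx).deriv]
    exact hα _ (sq_nonneg x)

theorem mul_comp_sq_sub_le_mul_sub (hm : ContDiffOn ℝ 1 m (Set.Ici 0))
    (hL : ∀ t, 0 ≤ t → m t + 2 * t * derivWithin m (Set.Ici 0) t ≤ L)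
    {s t : ℝ} (hs : 0 ≤ s) (hst : s ≤ t) :
    t * m (t ^ 2) - s * m (s ^ 2) ≤ L * (t - s) := by
  refine (convex_Ici (0 : ℝ)).image_sub_le_mul_sub_of_deriv_le
    (continuousOn_mul_comp_sq hm.continuousOn) ?_ ?_ s hs t (hs.trans hst) hst
  · intro x hx
    rw [interior_Ici] at hx
    exact (hasDerivAt_mul_comp_sq hm hx).differentiableAt.differentiableWithinAt
  · intro x hx
    rw [interior_Ici] at hx
    rw [(hasDerivAt_mul_comp_sq hm hx).deriv]
    exact hL _ (sq_nonneg x)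

/-- Compare the profile at s with its value 0 at the origin and divide by s; at s = 0 the derivative
term vanishes from the hypothesis. -/
theorem le_comp_sq_of_le_add_derivWithin (hm : ContDiffOn ℝ 1 m (Set.Ici 0))
    (hα : ∀ t, 0 ≤ t → α ≤ m t + 2 * t * derivWithin m (Set.Ici 0) t)
    {s : ℝ} (hs : 0 ≤ s) : α ≤ m (s ^ 2) := by
  rcases hs.eq_or_lt with rfl | hs
  · simpa using hα 0 le_rfl
  · have h := mul_sub_le_mul_comp_sq_sub hm hα le_rfl hs.le
    refine le_of_mul_le_mul_left (a := s) ?_ hs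
    linarith

theorem comp_sq_le_of_add_derivWithin_le (hm : ContDiffOn ℝ 1 m (Set.Ici 0))
    (hL : ∀ t, 0 ≤ t → m t + 2 * t * derivWithin m (Set.Ici 0) t ≤ L)
    {s : ℝ} (hs : 0 ≤ s) : m (s ^ 2) ≤ L := by
  rcases hs.eq_or_lt with rfl | hs
  · simpa using hL 0 le_rfl
  · have h := mul_comp_sq_sub_le_mul_sub hm hL le_rfl hs.le
    refine le_of_mul_le_mul_left (a := s) ?_ hs
    linarith

variable {E : Type*} [NormedAddCommGroup E] [InnerProductSpace ℝ E]

/-- With a = m(|ξ|²) and b = m(|η|²), the right side is (a|ξ| - b|η|)(|ξ| - |η|) + (a + b)(|ξ||η| -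
⟨ξ,η⟩). The left side is α(|ξ| - |η|)² + 2α(|ξ||η| - ⟨ξ,η⟩). The radial terms compare by the slope
bound (`h3`), the angular ones by a, b ≥ α (`h4`). -/
theorem mul_norm_sub_sq_le_inner_smul_sub_smul (hm : ContDiffOn ℝ 1 m (Set.Ici 0))
    (hα : ∀ t, 0 ≤ t → α ≤ m t + 2 * t * derivWithin m (Set.Ici 0) t) (ξ η : E) :
    α * ‖ξ - η‖ ^ 2 ≤ ⟪m (‖ξ‖ ^ 2) • ξ - m (‖η‖ ^ 2) • η, ξ - η⟫ := by
  have h1 := le_comp_sq_of_le_add_derivWithin hm hα (norm_nonneg ξ)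
  have h2 := le_comp_sq_of_le_add_derivWithin hm hα (norm_nonneg η)
  have h3 : 0 ≤ ((‖ξ‖ * m (‖ξ‖ ^ 2) - ‖η‖ * m (‖η‖ ^ 2)) - α * (‖ξ‖ - ‖η‖)) * (‖ξ‖ - ‖η‖) := by
    rcases le_total ‖ξ‖ ‖η‖ with h | h
    · have := mul_sub_le_mul_comp_sq_sub hm hα (norm_nonneg ξ) h
      exact mul_nonneg_of_nonpos_of_nonpos (by linarith) (by linarith)
    · have := mul_sub_le_mul_comp_sq_sub hm hα (norm_nonneg η) h
      exact mul_nonneg (by linarith) (by linarith)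
  have h4 := mul_nonneg (add_nonneg (sub_nonneg.2 h1) (sub_nonneg.2 h2))
    (sub_nonneg.2 (real_inner_le_norm ξ η))
  rw [norm_sub_sq_real]
  simp only [inner_sub_left, inner_sub_right, real_inner_smul_left,
    real_inner_self_eq_norm_sq, real_inner_comm ξ η]
  linarith

/-- The same splitting of the squared norms: (a|ξ| - b|η|)² + 2ab(|ξ||η| - ⟨ξ,η⟩), with ab ≤ L². The
condition α ≥ 0 makes the profile monotone and a, b nonnegative, so the upper slope bound controls
absolute values. -/
theorem norm_smul_sub_smul_le (hm : ContDiffOn ℝ 1 m (Set.Ici 0)) (hα0 : 0 ≤ α)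
    (hα : ∀ t, 0 ≤ t → α ≤ m t + 2 * t * derivWithin m (Set.Ici 0) t)
    (hL : ∀ t, 0 ≤ t → m t + 2 * t * derivWithin m (Set.Ici 0) t ≤ L) (ξ η : E) :
    ‖m (‖ξ‖ ^ 2) • ξ - m (‖η‖ ^ 2) • η‖ ≤ L * ‖ξ - η‖ := by
  have a1 := hα0.trans (le_comp_sq_of_le_add_derivWithin hm hα (norm_nonneg ξ))
  have a2 := hα0.trans (le_comp_sq_of_le_add_derivWithin hm hα (norm_nonneg η))
  have b1 := comp_sq_le_of_add_derivWithin_le hm hL (norm_nonneg ξ)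
  have b2 := comp_sq_le_of_add_derivWithin_le hm hL (norm_nonneg η)
  have hL0 : 0 ≤ L := a1.trans b1
  have h3 : (‖ξ‖ * m (‖ξ‖ ^ 2) - ‖η‖ * m (‖η‖ ^ 2)) ^ 2 ≤ (L * (‖ξ‖ - ‖η‖)) ^ 2 := by
    rcases le_total ‖ξ‖ ‖η‖ with h | h
    · have l := mul_sub_le_mul_comp_sq_sub hm hα (norm_nonneg ξ) h
      have u := mul_comp_sq_sub_le_mul_sub hm hL (norm_nonneg ξ) h
      have := mul_nonneg hα0 (sub_nonneg.2 h)
      rw [sq_le_sq, abs_of_nonpos (by linarith), abs_of_nonpos (by linarith)]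
      linarith
    · have l := mul_sub_le_mul_comp_sq_sub hm hα (norm_nonneg η) h
      have u := mul_comp_sq_sub_le_mul_sub hm hL (norm_nonneg η) h
      have := mul_nonneg hα0 (sub_nonneg.2 h)
      rw [sq_le_sq, abs_of_nonneg (by linarith), abs_of_nonneg (by linarith)]
      linarith
  have h4 := mul_nonneg (sub_nonneg.2 (mul_le_mul b1 b2 a2 hL0))
    (sub_nonneg.2 (real_inner_le_norm ξ η))
  refine le_of_sq_le_sq ?_ (by positivity)
  rw [mul_pow, norm_sub_sq_real, norm_sub_sq_real]
  simp only [norm_smul, Real.norm_of_nonneg a1, Real.norm_of_nonneg a2, real_inner_smul_left,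
    real_inner_smul_right]
  linarith

theorem hasDerivAt_half_integral_norm_sq (hm : Continuous m) (ξ η : E) :
    HasDerivAt (fun r : ℝ => 1 / 2 * ∫ ζ in (0 : ℝ)..‖ξ + r • η‖ ^ 2, m ζ)
      (m (‖ξ‖ ^ 2) * ⟪ξ, η⟫) 0 := by
  have h1 : HasDerivAt (fun r : ℝ => ‖ξ + r • η‖ ^ 2) (2 * ⟪ξ, η⟫) 0 := by
    have h : HasDerivAt (fun r : ℝ => ξ + r • η) η 0 := by
      simpa using ((hasDerivAt_id (0 : ℝ)).smul_const η).const_add ξ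
    simpa using h.norm_sq
  have h2 : HasDerivAt (fun s : ℝ => ∫ ζ in (0 : ℝ)..s, m ζ) (m (‖ξ‖ ^ 2)) (‖ξ + (0 : ℝ) • η‖ ^ 2) := by
    simpa using (hm.integral_hasStrictDerivAt 0 (‖ξ‖ ^ 2)).hasDerivAt
  refine ((h2.comp (0 : ℝ) h1).const_mul (1 / 2)).congr_deriv ?_
  ring

/-- Supplies a dominating function independent of r: |ξ+rη|² - |ξ|² contains a factor r that cancels
the denominator. -/
theorem abs_half_integral_norm_sq_sub_div_le {C : ℝ} (hm : Continuous m)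
    (hC : ∀ t, 0 ≤ t → |m t| ≤ C) (ξ η : E) {r : ℝ} (hr : |r| ≤ 1) :
    |(1 / 2 * (∫ ζ in (0 : ℝ)..‖ξ + r • η‖ ^ 2, m ζ) - 1 / 2 * ∫ ζ in (0 : ℝ)..‖ξ‖ ^ 2, m ζ) / r|
      ≤ C * (‖ξ‖ ^ 2 + ‖η‖ ^ 2) := by
  have hC0 : 0 ≤ C := (abs_nonneg _).trans (hC 0 le_rfl)
  rcases eq_or_ne r 0 with rfl | hr0
  · simp only [div_zero, abs_zero]
    positivity
  have hr0' : 0 < |r| := abs_pos.2 hr0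
  have h1 : |∫ ζ in (‖ξ‖ ^ 2)..‖ξ + r • η‖ ^ 2, m ζ| ≤ C * |‖ξ + r • η‖ ^ 2 - ‖ξ‖ ^ 2| := by
    refine intervalIntegral.norm_integral_le_of_norm_le_const (f := m) fun ζ hζ => hC ζ ?_
    exact (le_min (sq_nonneg _) (sq_nonneg _)).trans (Set.mem_uIoc.1 hζ |>.elim
      (fun h => (min_le_left _ _).trans h.1.le) (fun h => (min_le_right _ _).trans h.1.le))
  have h2 : ‖ξ + r • η‖ ^ 2 - ‖ξ‖ ^ 2 = r * (2 * ⟪ξ, η⟫ + r * ‖η‖ ^ 2) := by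
    rw [norm_add_sq_real, real_inner_smul_right, norm_smul, mul_pow, Real.norm_eq_abs, sq_abs]
    ring
  have h3 : |2 * ⟪ξ, η⟫ + r * ‖η‖ ^ 2| ≤ 2 * (‖ξ‖ ^ 2 + ‖η‖ ^ 2) := by
    have i1 := abs_real_inner_le_norm ξ η
    have i2 : |r| * ‖η‖ ^ 2 ≤ 1 * ‖η‖ ^ 2 := by gcongr
    have i3 := abs_add_le (2 * ⟪ξ, η⟫) (r * ‖η‖ ^ 2)
    rw [abs_mul, abs_mul, abs_two, abs_of_nonneg (sq_nonneg ‖η‖)] at i3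
    nlinarith [sq_nonneg (‖ξ‖ - ‖η‖), sq_nonneg ‖ξ‖]
  rw [← mul_sub, intervalIntegral.integral_interval_sub_left (hm.intervalIntegrable _ _)
    (hm.intervalIntegrable _ _), abs_div, div_le_iff₀ hr0', abs_mul]
  rw [h2, abs_mul] at h1
  rw [abs_of_pos (by norm_num : (0 : ℝ) < 1 / 2)]
  have h4 := mul_le_mul_of_nonneg_left h3 (mul_nonneg hC0 hr0'.le)
  linarith

end Pointwise

/-! ### Carathéodory functions -/

section Caratheodory

variable {X : Type*} [MeasurableSpace X]

/-- A function that is a.e. measurable in the first variable and, for a.e. first variable,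
continuous on `[0,∞)` in the second one has a jointly measurable modification that is continuous
in the second variable. -/
theorem exists_measurable_uncurry_continuous_eqOn {τ : Measure X} {f : X → ℝ → ℝ}
    (hf : ∀ t, 0 ≤ t → AEMeasurable (fun x => f x t) τ)
    (hc : ∀ᵐ x ∂τ, ContinuousOn (f x) (Set.Ici 0)) :
    ∃ g : X → ℝ → ℝ, Measurable (Function.uncurry g) ∧ (∀ x, Continuous (g x)) ∧
      ∀ᵐ x ∂τ, Set.EqOn (f x) (g x) (Set.Ici 0) := by
  classical
  -- Countably many sample points k/n allow a single null set to serve all of them.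
  have hq : ∀ k n : ℕ, AEMeasurable (fun x => f x ((k : ℝ) / n)) τ := fun k n => hf _ (by positivity)
  have hgood : ∀ᵐ x ∂τ, ContinuousOn (f x) (Set.Ici 0) ∧
      ∀ k n : ℕ, f x ((k : ℝ) / n) = (hq k n).mk _ x := by
    filter_upwards [hc, ae_all_iff.2 fun k => ae_all_iff.2 fun n => (hq k n).ae_eq_mk] with x h1 h2
    exact ⟨h1, h2⟩
  obtain ⟨S, hS, hSm, hSτ⟩ := hgood.exists_measurable_mem
  -- Clamping at 0 extends f(x,·) continuously to all of ℝ; off the full-measure set S the function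
  -- is zero.
  let g : X → ℝ → ℝ := fun x t => if x ∈ S then f x (max t 0) else 0
  have hgc : ∀ x, Continuous (g x) := by
    intro x
    by_cases hx : x ∈ S
    · simp only [g, hx, if_true]
      exact (hSτ x hx).1.comp_continuous (by fun_prop) fun t => le_max_right t 0
    · simp only [g, hx, if_false]
      exact continuous_const
  have hgq : ∀ k n : ℕ, Measurable fun x => g x ((k : ℝ) / n) := by
    intro k n
    have : (fun x => g x ((k : ℝ) / n)) = fun x => if x ∈ S then (hq k n).mk _ x else 0 := by
      funext x
      by_cases hx : x ∈ S
      · have h0 : (0 : ℝ) ≤ (k : ℝ) / n := by positivity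
        simp only [g, hx, if_true, max_eq_left h0]
        exact (hSτ x hx).2 k n
      · simp only [g, hx, if_false]
    rw [this]
    exact (hq k n).measurable_mk.ite hSm measurable_const
  have hgt : ∀ t, 0 ≤ t → Measurable fun x => g x t := by
    intro t ht
    -- By continuity, g(x,t) is the limit of its values at the sample points ⌊tn⌋/n → t.
    refine measurable_of_tendsto_metrizable (fun n : ℕ => hgq ⌊t * n⌋₊ n)
      (tendsto_pi_nhds.2 fun x => ?_)
    exact ((hgc x).tendsto t).comp
      ((tendsto_nat_floor_mul_div_atTop ht).comp tendsto_natCast_atTop_atTop)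
  have hgm : ∀ t, Measurable fun x => g x t := by
    intro t
    have : (fun x => g x t) = fun x => g x (max t 0) := by
      funext x
      simp only [g, max_assoc, max_self]
    rw [this]
    exact hgt _ (le_max_right t 0)
  refine ⟨g, ?_, hgc, ?_⟩
  · have h := measurable_uncurry_of_continuous_of_measurable (u := fun t x => g x t) hgc hgm
    exact h.comp measurable_swap
  · filter_upwards [hS] with x hx t ht
    simp only [g, hx, if_true, max_eq_left (Set.mem_Ici.1 ht)]

/-- The primitive is again Carathéodory: continuous in s, and measurable in x as a difference of
parameter integrals. -/
theorem measurable_uncurry_intervalIntegral {g : X → ℝ → ℝ} (hg : Measurable (Function.uncurry g))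
    (hc : ∀ x, Continuous (g x)) :
    Measurable (Function.uncurry fun x s => ∫ ζ in (0 : ℝ)..s, g x ζ) := by
  have h := measurable_uncurry_of_continuous_of_measurable
    (u := fun s x => ∫ ζ in (0 : ℝ)..s, g x ζ)
    (fun x => intervalIntegral.continuous_primitive (fun a b => (hc x).intervalIntegrable a b) 0)
    (fun s => by
      simp only [intervalIntegral]
      exact (hg.stronglyMeasurable.integral_prod_right.sub
        hg.stronglyMeasurable.integral_prod_right).measurable)
  exact h.comp measurable_swap

end Caratheodory

/-! ### Nemytskii operators -/

section Nemytskii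

variable {X E : Type*} [MeasurableSpace X] [NormedAddCommGroup E] {τ : Measure X} {f : X → ℝ → ℝ}
  {C : ℝ}

theorem aestronglyMeasurable_comp_norm_sq
    (hf : ∀ t, 0 ≤ t → AEMeasurable (fun x => f x t) τ)
    (hc : ∀ᵐ x ∂τ, ContinuousOn (f x) (Set.Ici 0)) {G : X → E} (hG : AEStronglyMeasurable G τ) :
    AEStronglyMeasurable (fun x => f x (‖G x‖ ^ 2)) τ := by
  obtain ⟨g, hg, -, hfg⟩ := exists_measurable_uncurry_continuous_eqOn hf hc
  have h : AEMeasurable (fun x => g x (‖G x‖ ^ 2)) τ :=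
    hg.comp_aemeasurable (aemeasurable_id.prodMk (hG.norm.aemeasurable.pow_const 2))
  refine (h.congr ?_).aestronglyMeasurable
  filter_upwards [hfg] with x hx
  exact (hx (Set.mem_Ici.2 (sq_nonneg _))).symm

theorem memLp_comp_norm_sq_smul [NormedSpace ℝ E]
    (hf : ∀ t, 0 ≤ t → AEMeasurable (fun x => f x t) τ)
    (hc : ∀ᵐ x ∂τ, ContinuousOn (f x) (Set.Ici 0))
    (hC : ∀ᵐ x ∂τ, ∀ t, 0 ≤ t → |f x t| ≤ C) {p : ℝ≥0∞} {G : X → E} (hG : MemLp G p τ) :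
    MemLp (fun x => f x (‖G x‖ ^ 2) • G x) p τ := by
  refine hG.of_le_mul (c := C) ((aestronglyMeasurable_comp_norm_sq hf hc hG.1).smul hG.1) ?_
  filter_upwards [hC] with x hx
  rw [norm_smul]
  exact mul_le_mul_of_nonneg_right (hx _ (sq_nonneg _)) (norm_nonneg _)

theorem integrable_intervalIntegral_norm_sq
    (hf : ∀ t, 0 ≤ t → AEMeasurable (fun x => f x t) τ)
    (hc : ∀ᵐ x ∂τ, ContinuousOn (f x) (Set.Ici 0))
    (hC : ∀ᵐ x ∂τ, ∀ t, 0 ≤ t → |f x t| ≤ C) {G : X → E} (hG : MemLp G 2 τ) :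
    Integrable (fun x => ∫ ζ in (0 : ℝ)..‖G x‖ ^ 2, f x ζ) τ := by
  obtain ⟨g, hg, hgc, hfg⟩ := exists_measurable_uncurry_continuous_eqOn hf hc
  have h : AEMeasurable (fun x => ∫ ζ in (0 : ℝ)..‖G x‖ ^ 2, g x ζ) τ :=
    (measurable_uncurry_intervalIntegral hg hgc).comp_aemeasurable
      (aemeasurable_id.prodMk (hG.1.norm.aemeasurable.pow_const 2))
  refine ((hG.integrable_norm_pow two_ne_zero).const_mul C).mono' (h.congr ?_).aestronglyMeasurable ?_
  · filter_upwards [hfg] with x hx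
    refine intervalIntegral.integral_congr fun ζ hζ => ?_
    rw [Set.uIcc_of_le (sq_nonneg _)] at hζ
    exact (hx hζ.1).symm
  · filter_upwards [hC] with x hx
    have h1 := intervalIntegral.norm_integral_le_of_norm_le_const (f := f x) (a := 0)
      (b := ‖G x‖ ^ 2) (C := C) fun ζ hζ => by
        rw [Set.uIoc_of_le (sq_nonneg _)] at hζ
        exact hx ζ hζ.1.le
    simpa using h1

variable [InnerProductSpace ℝ E]

/-- Gâteaux derivative of `G ↦ ½ ∫ ∫₀^{|G|²} f dζ dτ` on `L²`. -/
theorem tendsto_integral_intervalIntegral_norm_sq_sub_div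
    (hf : ∀ t, 0 ≤ t → AEMeasurable (fun x => f x t) τ)
    (hc : ∀ᵐ x ∂τ, ContinuousOn (f x) (Set.Ici 0))
    (hC : ∀ᵐ x ∂τ, ∀ t, 0 ≤ t → |f x t| ≤ C) {G H : X → E} (hG : MemLp G 2 τ) (hH : MemLp H 2 τ) :
    Tendsto (fun r : ℝ => (1 / 2 * (∫ x, (∫ ζ in (0 : ℝ)..‖G x + r • H x‖ ^ 2, f x ζ) ∂τ)
        - 1 / 2 * ∫ x, (∫ ζ in (0 : ℝ)..‖G x‖ ^ 2, f x ζ) ∂τ) / r) (𝓝[≠] 0)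
      (𝓝 (∫ x, f x (‖G x‖ ^ 2) * ⟪G x, H x⟫ ∂τ)) := by
  -- A continuous extension to ℝ permits two-sided differentiation of the primitive even where G x =
  -- 0.
  have hext : ∀ᵐ x ∂τ, ∃ m : ℝ → ℝ, Continuous m ∧ Set.EqOn (f x) m (Set.Ici 0) := by
    filter_upwards [hc] with x hx
    refine ⟨fun t => f x (max t 0), hx.comp_continuous (by fun_prop) fun t => le_max_right t 0,
      fun t ht => ?_⟩
    simp only [max_eq_left (Set.mem_Ici.1 ht)]
  have hcongr : ∀ {m₁ m₂ : ℝ → ℝ}, Set.EqOn m₁ m₂ (Set.Ici 0) → ∀ ξ : E,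
      ∫ ζ in (0 : ℝ)..‖ξ‖ ^ 2, m₁ ζ = ∫ ζ in (0 : ℝ)..‖ξ‖ ^ 2, m₂ ζ := by
    intro m₁ m₂ h ξ
    refine intervalIntegral.integral_congr fun ζ hζ => h ?_
    rw [Set.uIcc_of_le (sq_nonneg _)] at hζ
    exact hζ.1
  have hint : ∀ r : ℝ, Integrable (fun x => ∫ ζ in (0 : ℝ)..‖G x + r • H x‖ ^ 2, f x ζ) τ :=
    fun r => integrable_intervalIntegral_norm_sq hf hc hC (hG.add (hH.const_smul r))
  have hint0 := integrable_intervalIntegral_norm_sq hf hc hC hG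
  have hmain : Tendsto (fun r : ℝ => ∫ x, (1 / 2 * (∫ ζ in (0 : ℝ)..‖G x + r • H x‖ ^ 2, f x ζ)
      - 1 / 2 * ∫ ζ in (0 : ℝ)..‖G x‖ ^ 2, f x ζ) / r ∂τ) (𝓝[≠] 0)
      (𝓝 (∫ x, f x (‖G x‖ ^ 2) * ⟪G x, H x⟫ ∂τ)) := by
    refine tendsto_integral_filter_of_dominated_convergence
      (fun x => C * (‖G x‖ ^ 2 + ‖H x‖ ^ 2)) ?_ ?_ ?_ ?_
    · exact Eventually.of_forall fun r =>
        ((((hint r).const_mul _).sub (hint0.const_mul _)).div_const r).1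
    · have hr : ∀ᶠ r : ℝ in 𝓝[≠] 0, |r| ≤ 1 := by
        refine eventually_nhdsWithin_of_eventually_nhds ?_
        filter_upwards [Metric.closedBall_mem_nhds (0 : ℝ) one_pos] with r hr
        simpa using hr
      filter_upwards [hr] with r hr
      filter_upwards [hext, hC] with x ⟨m, hm, hfm⟩ hx
      rw [hcongr hfm, hcongr hfm]
      exact abs_half_integral_norm_sq_sub_div_le hm (fun t ht => hfm ht ▸ hx t ht) _ _ hr
    · exact ((hG.integrable_norm_pow two_ne_zero).add
        (hH.integrable_norm_pow two_ne_zero)).const_mul C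
    · filter_upwards [hext] with x ⟨m, hm, hfm⟩
      have h := (hasDerivAt_half_integral_norm_sq hm (G x) (H x)).tendsto_slope
      rw [hfm (sq_nonneg ‖G x‖)]
      refine h.congr fun r => ?_
      rw [hcongr hfm, hcongr hfm, slope_def_field, zero_smul, add_zero, sub_zero]
  refine hmain.congr fun r => ?_
  rw [integral_div, integral_sub ((hint r).const_mul _) (hint0.const_mul _), integral_const_mul,
    integral_const_mul]

end Nemytskii

/-! ### Functionals on the Sobolev space induced by L² fluxes -/

namespace H1D

variable {d : ℕ} {Ω ΓD : Set (EuclideanSpace ℝ (Fin d))}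

/-- The weak gradient as a continuous linear map. -/
noncomputable def gradCLM : H1D Ω ΓD →L[ℝ] Lp (EuclideanSpace ℝ (Fin d)) 2 (volume.restrict Ω) :=
  (grad (Ω := Ω) (ΓD := ΓD)).mkContinuous 1 fun v => (one_mul ‖v‖).ge

theorem norm_grad (v : H1D Ω ΓD) : ‖v.grad‖ = ‖v‖ := rfl

theorem grad_add_smul_ae (w v : H1D Ω ΓD) (r : ℝ) :
    ∀ᵐ x ∂(volume.restrict Ω), (w + r • v).grad x = w.grad x + r • v.grad x := by
  rw [map_add, map_smul]
  exact (coeFn_add_smul_ae r w.grad v.grad).symm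

/-- The functional `v ↦ ∫_Ω F · ∇v dx` for a vector field `F ∈ L²(Ω; ℝᵈ)`. -/
noncomputable def ofFlux (F : Lp (EuclideanSpace ℝ (Fin d)) 2 (volume.restrict Ω)) :
    StrongDual ℝ (H1D Ω ΓD) :=
  (innerSL ℝ F).comp gradCLM

theorem ofFlux_apply (F : Lp (EuclideanSpace ℝ (Fin d)) 2 (volume.restrict Ω)) (v : H1D Ω ΓD) :
    ofFlux F v = ⟪F, v.grad⟫ := rfl

theorem ofFlux_sub (F F' : Lp (EuclideanSpace ℝ (Fin d)) 2 (volume.restrict Ω)) :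
    (ofFlux F - ofFlux F' : StrongDual ℝ (H1D Ω ΓD)) = ofFlux (F - F') := by
  ext v
  simp only [sub_apply, ofFlux_apply, inner_sub_left]

theorem norm_ofFlux_le (F : Lp (EuclideanSpace ℝ (Fin d)) 2 (volume.restrict Ω)) :
    ‖(ofFlux F : StrongDual ℝ (H1D Ω ΓD))‖ ≤ ‖F‖ := by
  refine ContinuousLinearMap.opNorm_le_bound _ (norm_nonneg F) fun v => ?_
  rw [ofFlux_apply, ← norm_grad v]
  exact norm_inner_le_norm _ _

end H1D

/-! ### The quasilinear operator and its potential -/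

theorem proposition8p2 {d : ℕ} (hd : d = 2 ∨ d = 3)
    {Ω ΓD ΓN : Set (EuclideanSpace ℝ (Fin d))}
    (hΩ : IsBoundedLipschitzDomain Ω) (hΩpoly : HasPolyhedralBoundary Ω)
    (hΓ : IsBoundarySplit Ω ΓD ΓN)
    (μ : EuclideanSpace ℝ (Fin d) → ℝ → ℝ)
    (hμ : ∀ t : ℝ, 0 ≤ t → AEMeasurable (fun x => μ x t) (volume.restrict Ω))
    {γ₁ γ₂ γ₁' γ₂' : ℝ}
    (hM1 : NonlinearityBounded Ω μ γ₁ γ₂)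
    (hM2 : NonlinearityDifferentiable Ω μ γ₁' γ₂') :
    ∃ A : H1D Ω ΓD → StrongDual ℝ (H1D Ω ΓD),
      (∀ w v : H1D Ω ΓD, IntegrableOn (operatorDensity μ w v) Ω volume ∧
        A w v = ∫ x in Ω, operatorDensity μ w v x) ∧
      IsStronglyMonotoneWith γ₁' A ∧
      IsLipschitzContinuousWith γ₂' A ∧
      (∀ w : H1D Ω ΓD, (∀ᵐ x ∂(volume.restrict Ω),
          IntervalIntegrable (μ x) volume 0 (‖w.grad x‖ ^ 2)) ∧
        IntegrableOn (energyDensity μ w) Ω volume ∧ 0 ≤ energyPotential μ w) ∧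
      IsPotentialOf (energyPotential (Ω := Ω) (ΓD := ΓD) μ) A := by
  obtain ⟨hγ₁, -, hb⟩ := hM1
  obtain ⟨hα, hαL, hC1, hD⟩ := hM2
  have hmem : ∀ᵐ x ∂(volume.restrict Ω), x ∈ Ω := ae_restrict_mem hΩ.isOpen.measurableSet
  have hc : ∀ᵐ x ∂(volume.restrict Ω), ContinuousOn (μ x) (Set.Ici 0) := by
    filter_upwards [hmem] with x hx using (hC1 x hx).continuousOn
  have hC : ∀ᵐ x ∂(volume.restrict Ω), ∀ t, 0 ≤ t → |μ x t| ≤ γ₂ := by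
    filter_upwards [hmem] with x hx t ht
    rw [abs_of_nonneg (hγ₁.le.trans (hb x hx t ht).1)]
    exact (hb x hx t ht).2
  have hflux : ∀ w : H1D Ω ΓD,
      MemLp (fun x => μ x (‖w.grad x‖ ^ 2) • w.grad x) 2 (volume.restrict Ω) :=
    fun w => memLp_comp_norm_sq_smul hμ hc hC (Lp.memLp _)
  let flux : H1D Ω ΓD → Lp (EuclideanSpace ℝ (Fin d)) 2 (volume.restrict Ω) :=
    fun w => (hflux w).toLp
  have hfluxae : ∀ w, flux w =ᵐ[volume.restrict Ω] fun x => μ x (‖w.grad x‖ ^ 2) • w.grad x :=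
    fun w => (hflux w).coeFn_toLp
  have hdens : ∀ w v : H1D Ω ΓD,
      (fun x => ⟪flux w x, v.grad x⟫) =ᵐ[volume.restrict Ω] operatorDensity μ w v := by
    intro w v
    filter_upwards [hfluxae w] with x hx
    rw [hx, real_inner_smul_left, operatorDensity]
  have hA : ∀ w v : H1D Ω ΓD,
      H1D.ofFlux (flux w) v = ∫ x in Ω, operatorDensity μ w v x := fun w v => by
    rw [H1D.ofFlux_apply, L2.inner_def, integral_congr_ae (hdens w v)]
  refine ⟨fun w => H1D.ofFlux (flux w), fun w v => ⟨?_, hA w v⟩, ⟨hα, fun v w => ?_⟩,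
    ⟨hα.trans hαL, fun v w => ?_⟩, fun w => ⟨?_, ?_, ?_⟩, fun v w => ?_⟩
  · exact (L2.integrable_inner (𝕜 := ℝ) (flux w) v.grad).congr (hdens w v)
  -- Both sides become integrals of inner products, so the pointwise monotonicity can be integrated.
  · rw [H1D.ofFlux_sub, H1D.ofFlux_apply, ← H1D.norm_grad, ← real_inner_self_eq_norm_sq,
      L2.inner_def, L2.inner_def, ← integral_const_mul]
    refine integral_mono_ae ((L2.integrable_inner (𝕜 := ℝ) _ _).const_mul _)
      (L2.integrable_inner (𝕜 := ℝ) _ _) ?_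
    filter_upwards [hmem, hfluxae w, hfluxae v, Lp.coeFn_sub (flux w) (flux v),
      Lp.coeFn_sub w.grad v.grad] with x hx hw hv h1 h2
    rw [map_sub, h1, h2, Pi.sub_apply, Pi.sub_apply, hw, hv, real_inner_self_eq_norm_sq]
    exact mul_norm_sub_sq_le_inner_smul_sub_smul (hC1 x hx) (fun t ht => (hD x hx t ht).1) _ _
  · rw [H1D.ofFlux_sub, ← H1D.norm_grad, map_sub]
    refine (H1D.norm_ofFlux_le _).trans (Lp.norm_le_mul_norm_of_ae_le_mul ?_)
    filter_upwards [hmem, hfluxae w, hfluxae v, Lp.coeFn_sub (flux w) (flux v),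
      Lp.coeFn_sub w.grad v.grad] with x hx hw hv h1 h2
    rw [h1, h2, Pi.sub_apply, Pi.sub_apply, hw, hv]
    exact norm_smul_sub_smul_le (hC1 x hx) hα.le (fun t ht => (hD x hx t ht).1)
      (fun t ht => (hD x hx t ht).2) _ _
  · filter_upwards [hc] with x hx
    refine (hx.mono fun t ht => ?_).intervalIntegrable
    rw [Set.uIcc_of_le (sq_nonneg _)] at ht
    exact ht.1
  · exact integrable_intervalIntegral_norm_sq hμ hc hC (Lp.memLp w.grad)
  · refine mul_nonneg (by norm_num) (integral_nonneg_of_ae ?_)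
    filter_upwards [hmem] with x hx
    exact intervalIntegral.integral_nonneg (sq_nonneg _) fun t ht =>
      hγ₁.le.trans (hb x hx t ht.1).1
  · have h := tendsto_integral_intervalIntegral_norm_sq_sub_div hμ hc hC (Lp.memLp w.grad)
      (Lp.memLp v.grad)
    rw [show H1D.ofFlux (flux w) v = _ from hA w v]
    refine h.congr fun r => ?_
    -- The chosen representative of ∇(w + rv) agrees with ∇w + r∇v only almost everywhere, hence the
    -- exchange under the integral.
    have hr : ∫ x in Ω, energyDensity μ (w + r • v) x
        = ∫ x in Ω, ∫ ζ in (0 : ℝ)..‖w.grad x + r • v.grad x‖ ^ 2, μ x ζ := by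
      refine integral_congr_ae ?_
      filter_upwards [H1D.grad_add_smul_ae w v r] with x hx
      rw [energyDensity, hx]
    simp only [energyPotential, hr]
    rfl
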